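/- Let $(S,\mathscr A,\mu)$ be a finite measure space and let $X$ be a (real or complex) Banach space with scalar field $\mathbb K$. Let $X^*$ be its dual, and suppose that (i) $X$ is weakly sequentially complete: if $(x_n)$ is a sequence in $X$ such that $(x^*(x_n))_n$ is Cauchy for every $x^*\in X^*$, then $(x_n)$ converges weakly to an element of $X$; (ii) $X$ has the Radon–Nikodym property with respect to $(S,\mathscr A,\mu)$: for every countably additive $F:\mathscr A\to X$ of bounded variation such that $F(A)=0$ whenever $A\in\mathscr A$ and $\mu(A)=0$, there is $\phi\in L^1(S,X)$ with $F(A)=\int_A\phi\,d\mu$ for all $A\in\mathscr A$. Let $S^\infty(S,X^*)$ be the closure in $L^\infty(S,X^*)$ of the space of $\mu$-simple functions $\sum_{i=1}^r\chi_{E_i}x_i^*$ ($E_i\in\mathscr A$, $\mu(E_i)<\infty$, $x_i^*\in X^*$), and pair it with $L^1(S,X)$ by $\langle\phi,f\rangle=\int_S f(s)(\phi(s))\,d\mu(s)$. Then $L^1(S,X)$ is $\sigma(L^1(S,X),S^\infty(S,X^*))$-sequentially complete: if $(\phi_n)$ is a sequence in $L^1(S,X)$ such that the scalar sequence $(\langle\phi_n,f\rangle)_n$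 is Cauchy for every $f\in S^\infty(S,X^*)$, then there is $\phi\in L^1(S,X)$ such that $\phi_n\to\phi$ in the $\sigma(L^1(S,X),S^\infty(S,X^*))$-topology. -/

import Mathlib

open MeasureTheory Filter Topology
open scoped ENNReal

noncomputable section

/-- Sequential completeness of `E` for the topology `σ(E, F)` given by the pairing `B`: every
sequence `u` in `E` such that `B (u n) y` is Cauchy for each `y` in `F` converges in the topology
`σ(E, F)` to an element of `E`. -/
def SigmaSequentiallyComplete {𝕜 E F : Type*} [NormedField 𝕜] [AddCommGroup E] [Module 𝕜 E]
    [AddCommGroup F] [Module 𝕜 F] (B : E →ₗ[𝕜] F →ₗ[𝕜] 𝕜) : Prop :=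
  ∀ u : ℕ → WeakBilin B, (∀ y : F, CauchySeq fun n => B (u n) y) →
    ∃ x : WeakBilin B, Tendsto u atTop (𝓝 x)

/-- Weak sequential completeness: every weakly Cauchy sequence in `X` converges weakly to an
element of `X`. -/
def WeaklySequentiallyComplete (𝕜 X : Type*) [RCLike 𝕜] [NormedAddCommGroup X]
    [NormedSpace 𝕜 X] : Prop :=
  ∀ u : ℕ → X, (∀ f : StrongDual 𝕜 X, CauchySeq fun n => f (u n)) →
    ∃ x : X, Tendsto (fun n => toWeakSpace 𝕜 X (u n)) atTop (𝓝 (toWeakSpace 𝕜 X x))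

/-- The Radon-Nikodym property of `X` with respect to the measure space `(S, μ)`: every
countably additive `X`-valued measure `F` of bounded variation which is absolutely continuous with
respect to `μ` has a density in `L¹(S, X)`. -/
def HasRNP {S : Type*} [MeasurableSpace S] (μ : Measure S) (X : Type*) [NormedAddCommGroup X]
    [NormedSpace ℝ X] : Prop :=
  ∀ F : VectorMeasure S X, F.variation Set.univ < ∞ →
    (∀ A : Set S, MeasurableSet A → μ A = 0 → F A = 0) →
    ∃ φ : Lp X 1 μ, ∀ A : Set S, MeasurableSet A → F A = ∫ s in A, φ s ∂μ

/-- `S^∞(S, Y)`: the closure in `L^∞(S, Y)` of the space of `μ`-simple functions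
`∑ i, χ_{A i} y_i` with `A i` measurable of finite measure. -/
def SInfty (𝕜 : Type*) [RCLike 𝕜] {S : Type*} [MeasurableSpace S] (μ : Measure S) (Y : Type*)
    [NormedAddCommGroup Y] [NormedSpace 𝕜 Y] : Submodule 𝕜 (Lp Y ∞ μ) :=
  (Submodule.span 𝕜 {f : Lp Y ∞ μ | ∃ (A : Set S) (hA : MeasurableSet A) (hμA : μ A ≠ ∞) (y : Y),
    f = indicatorConstLp ∞ hA hμA y}).topologicalClosure

/-- The pairing `⟨φ, f⟩ = ∫ s, f s (φ s) ∂μ` of `L¹(S, X)` with `S^∞(S, X*)`. -/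
def pairingSInfty (𝕜 : Type*) [RCLike 𝕜] {S : Type*} [MeasurableSpace S] (μ : Measure S)
    (X : Type*) [NormedAddCommGroup X] [NormedSpace 𝕜 X] :
    Lp X 1 μ →ₗ[𝕜] SInfty 𝕜 μ (StrongDual 𝕜 X) →ₗ[𝕜] 𝕜 :=
  LinearMap.mk₂ 𝕜
    (fun φ f => (ContinuousLinearMap.apply 𝕜 𝕜).lpPairing μ 1 ∞ φ (f : Lp (StrongDual 𝕜 X) ∞ μ))
    (fun _ _ _ => by simp) (fun _ _ _ => by simp) (fun _ _ _ => by simp) (fun _ _ _ => by simp)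

/-- The pairing is the integral it should be. -/
theorem pairingSInfty_apply (𝕜 : Type*) [RCLike 𝕜] {S : Type*} [MeasurableSpace S] (μ : Measure S)
    (X : Type*) [NormedAddCommGroup X] [NormedSpace 𝕜 X] (φ : Lp X 1 μ)
    (f : SInfty 𝕜 μ (StrongDual 𝕜 X)) :
    pairingSInfty 𝕜 μ X φ f = ∫ s, (f : Lp (StrongDual 𝕜 X) ∞ μ) s (φ s) ∂μ :=
  ContinuousLinearMap.lpPairing_eq_integral _ _ _

end

/-! By Banach–Steinhaus the pointwise limit `L` of the pairings is continuous on the Banach space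
`SInfty`. Weak sequential completeness turns the integrals of `u n` over a measurable `A` into a
weak limit `F A`, which represents `L` on `χ_A x*`. Testing `L` on simple functions built from
norming functionals bounds the variation of `F` by `‖L‖`, so each series `∑ F (A i)` over disjoint
sets converges absolutely; its sum is identified functional by functional through Nikodym's theorem.
That theorem rests on a Schur-type argument: Baire category on `ℕ → Bool`. The Radon–Nikodym
property then gives a density `φ`, and `L` is the pairing with `φ` because simple functions are
dense. -/

/-- If `a n` is a sequence of absolutely summable families whose sums over every subset of `ℕ`
form a Cauchy sequence, then the differences `a n - a N` have uniformly small tails. -/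
theorem exists_forall_norm_tsum_tail_sub_le {E : Type*} [NormedAddCommGroup E] [CompleteSpace E]
    {a : ℕ → ℕ → E} (ha : ∀ n, Summable fun i => ‖a n i‖)
    (hc : ∀ B : ℕ → Bool, CauchySeq fun n => ∑' i, if B i then a n i else 0)
    {ε : ℝ} (hε : 0 < ε) :
    ∃ k N : ℕ, ∀ n ≥ N, ∀ j ≥ k, ‖(∑' i, if j ≤ i then a n i else 0) -
      ∑' i, if j ≤ i then a N i else 0‖ ≤ ε := by
  set g : ℕ → (ℕ → Bool) → E := fun n B => ∑' i, if B i then a n i else 0 with hg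
  have hs : ∀ n (p : ℕ → Prop) [DecidablePred p], Summable fun i => if p i then a n i else 0 := by
    intro n p _
    refine .of_norm_bounded (ha n) fun i => ?_
    split_ifs <;> simp
  have hcont : ∀ n, Continuous (g n) := by
    intro n
    refine continuous_tsum (u := fun i => ‖a n i‖) (fun i => ?_) (ha n) fun i B => ?_
    · exact (continuous_of_discreteTopology (f := fun b : Bool => if b then a n i else 0)).comp
        (continuous_apply i)
    · split_ifs <;> simp
  -- Baire: these closed sets cover the compact space `ℕ → Bool`, so one of them has an interior
  -- point `B`.
  let K : ℕ → Set (ℕ → Bool) := fun N => {B | ∀ n ≥ N, ‖g n B - g N B‖ ≤ ε / 2}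
  have hK : ∀ N, IsClosed (K N) := by
    intro N
    simp only [K, Set.ofPred_forall]
    exact isClosed_iInter fun n => isClosed_iInter fun _ =>
      isClosed_le ((hcont n).sub (hcont N)).norm continuous_const
  have hU : ⋃ N, K N = Set.univ := by
    refine Set.eq_univ_of_forall fun B => ?_
    obtain ⟨N, hN⟩ := Metric.cauchySeq_iff'.1 (hc B) (ε / 2) (by positivity)
    refine Set.mem_iUnion.2 ⟨N, fun n hn => ?_⟩
    rw [← dist_eq_norm]
    exact (hN n hn).le
  obtain ⟨N, B, hB⟩ := nonempty_interior_of_iUnion_of_closed hK hU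
  rw [mem_interior_iff_mem_nhds, nhds_pi, Filter.mem_pi] at hB
  obtain ⟨I, hI, t, ht, hsub⟩ := hB
  obtain ⟨k, hk⟩ := hI.bddAbove
  -- The basic neighbourhood of `B` restricts only coordinates up to `k`; all later ones are free.
  refine ⟨k + 1, N, fun n hn j hj => ?_⟩
  have key : ∀ C : ℕ → Bool, (∀ i < j, C i = B i) → ‖g n C - g N C‖ ≤ ε / 2 := by
    intro C hC
    refine hsub (fun i hi => ?_) n hn
    rw [hC i (by have := hk hi; omega)]
    exact mem_of_mem_nhds (ht i)
  -- Switching every coordinate from `j` on to true, or to false, stays in `K N`; the difference of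
  -- the two sums is the tail.
  have h1 := key (fun i => B i || decide (j ≤ i)) fun i hi => by simp [hi]
  have h2 := key (fun i => B i && !decide (j ≤ i)) fun i hi => by simp [hi]
  have hdiff : ∀ m, (∑' i, if j ≤ i then a m i else 0) =
      g m (fun i => B i || decide (j ≤ i)) - g m (fun i => B i && !decide (j ≤ i)) := by
    intro m
    simp only [hg]
    rw [← (hs m _).tsum_sub (hs m _)]
    refine tsum_congr fun i => ?_
    by_cases hi : j ≤ i <;> simp [hi]
  rw [hdiff, hdiff, sub_sub_sub_comm]
  exact (norm_sub_le _ _).trans (by linarith)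

/-- Under the hypothesis of Schur's lemma, the limit of the sums is the sum of the limits. -/
theorem tendsto_sum_range_of_forall_cauchySeq_tsum {E : Type*} [NormedAddCommGroup E]
    [CompleteSpace E] {a : ℕ → ℕ → E} (ha : ∀ n, Summable fun i => ‖a n i‖)
    (hc : ∀ B : ℕ → Bool, CauchySeq fun n => ∑' i, if B i then a n i else 0)
    {c : ℕ → E} {b : E} (hac : ∀ i, Tendsto (fun n => a n i) atTop (𝓝 (c i)))
    (hb : Tendsto (fun n => ∑' i, a n i) atTop (𝓝 b)) :
    Tendsto (fun k => ∑ i ∈ Finset.range k, c i) atTop (𝓝 b) := by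
  rw [Metric.tendsto_atTop']
  intro ε hε
  obtain ⟨k, N, hkN⟩ := exists_forall_norm_tsum_tail_sub_le ha hc (ε := ε / 3) (by positivity)
  have hsplit : ∀ n j, (∑' i, if j ≤ i then a n i else 0) =
      (∑' i, a n i) - ∑ i ∈ Finset.range j, a n i := by
    intro n j
    rw [← (ha n).of_norm.sum_add_tsum_nat_add j, add_sub_cancel_left]
    have hs : Summable fun i => if j ≤ i then a n i else 0 := by
      refine .of_norm_bounded (ha n) fun i => ?_
      split_ifs <;> simp
    rw [← hs.sum_add_tsum_nat_add j, Finset.sum_eq_zero, zero_add]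
    · simp
    · intro i hi
      simp [Finset.mem_range.1 hi]
  obtain ⟨k', hk'⟩ := Metric.tendsto_atTop'.1 (ha N).of_norm.hasSum.tendsto_sum_nat (ε / 3)
    (by positivity)
  refine ⟨max k k', fun j hj => ?_⟩
  have hlim : Tendsto (fun n => (∑' i, a n i) - ∑ i ∈ Finset.range j, a n i) atTop
      (𝓝 (b - ∑ i ∈ Finset.range j, c i)) :=
    hb.sub (tendsto_finsetSum _ fun i _ => hac i)
  have hle : ‖b - ∑ i ∈ Finset.range j, c i‖ ≤ ε / 3 + ε / 3 := by
    refine le_of_tendsto hlim.norm ?_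
    filter_upwards [eventually_ge_atTop N] with n hn
    have h1 := hkN n hn j ((le_max_left _ _).trans hj.le)
    have h2 := (hk' j ((le_max_right _ _).trans_lt hj)).le
    rw [dist_eq_norm, norm_sub_rev] at h2
    rw [hsplit n j, hsplit N j] at h1
    have := norm_le_norm_add_norm_sub' ((∑' i, a n i) - ∑ i ∈ Finset.range j, a n i)
      ((∑' i, a N i) - ∑ i ∈ Finset.range j, a N i)
    linarith
  rw [dist_eq_norm, norm_sub_rev]
  linarith

/-- Nikodym's convergence theorem for densities: the setwise limit of the indefinite integrals of a
sequence of integrable functions is countably additive. -/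
theorem tendsto_sum_range_of_forall_tendsto_setIntegral {S E : Type*} [MeasurableSpace S]
    {μ : Measure S} [NormedAddCommGroup E] [NormedSpace ℝ E] [CompleteSpace E] {h : ℕ → S → E}
    (hi : ∀ n, Integrable (h n) μ) {ν : Set S → E}
    (hν : ∀ A, MeasurableSet A → Tendsto (fun n => ∫ s in A, h n s ∂μ) atTop (𝓝 (ν A)))
    {A : ℕ → Set S} (hA : ∀ i, MeasurableSet (A i)) (hd : Pairwise (Function.onFun Disjoint A)) :
    Tendsto (fun k => ∑ i ∈ Finset.range k, ν (A i)) atTop (𝓝 (ν (⋃ i, A i))) := by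
  -- A subfamily sum is the integral over one measurable set, so setwise convergence gives the
  -- Cauchy hypothesis for every `B`.
  have hB : ∀ n (B : ℕ → Bool), HasSum (fun i => if B i then ∫ s in A i, h n s ∂μ else 0)
      (∫ s in ⋃ i, {s | B i = true ∧ s ∈ A i}, h n s ∂μ) := by
    intro n B
    have := hasSum_integral_iUnion (μ := μ) (f := h n) (s := fun i => {s | B i = true ∧ s ∈ A i})
      (fun i => (MeasurableSet.const _).inter (hA i))
      (fun i j hij => (hd hij).mono (fun _ hs => hs.2) (fun _ hs => hs.2)) (hi n).integrableOn
    convert this using 2 with i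
    cases B i <;> simp
  refine tendsto_sum_range_of_forall_cauchySeq_tsum (a := fun n i => ∫ s in A i, h n s ∂μ)
    (fun n => ?_) (fun B => ?_) (fun i => hν _ (hA i)) ?_
  · refine .of_nonneg_of_le (fun _ => norm_nonneg _) (fun i => norm_integral_le_integral_norm _)
      (hasSum_integral_iUnion hA hd (hi n).norm.integrableOn).summable
  · simp_rw [fun n => (hB n B).tsum_eq]
    exact (hν _ (.iUnion fun i => (MeasurableSet.const _).inter (hA i))).cauchySeq
  · simp_rw [fun n => (hasSum_integral_iUnion hA hd (hi n).integrableOn).tsum_eq]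
    exact hν _ (.iUnion hA)

/-- A simple function with values in the unit ball has norm at most one in `L^∞`. -/
theorem norm_sum_indicatorConstLp_top_le_one {S Y ι : Type*} [MeasurableSpace S] {μ : Measure S}
    [IsFiniteMeasure μ] [NormedAddCommGroup Y] (s : Finset ι) {A : ι → Set S}
    (hA : ∀ i, MeasurableSet (A i)) (hd : (s : Set ι).PairwiseDisjoint A) {y : ι → Y}
    (hy : ∀ i, ‖y i‖ ≤ 1) :
    ‖∑ i ∈ s, indicatorConstLp ∞ (hA i) (measure_ne_top μ (A i)) (y i)‖ ≤ 1 := by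
  classical
  have hcoe : ∀ t : Finset ι,
      ⇑(∑ i ∈ t, indicatorConstLp ∞ (hA i) (measure_ne_top μ (A i)) (y i)) =ᵐ[μ]
        fun x => ∑ i ∈ t, (A i).indicator (fun _ => y i) x := by
    intro t
    induction t using Finset.induction_on with
    | empty =>
      simp only [Finset.sum_empty]
      exact Lp.coeFn_zero Y ∞ μ
    | insert i t hit ih =>
      rw [Finset.sum_insert hit]
      filter_upwards [Lp.coeFn_add (indicatorConstLp ∞ (hA i) (measure_ne_top μ (A i)) (y i))
        (∑ i ∈ t, indicatorConstLp ∞ (hA i) (measure_ne_top μ (A i)) (y i)), ih,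
        indicatorConstLp_coeFn (p := ∞) (hs := hA i) (hμs := measure_ne_top μ (A i)) (c := y i)]
        with x h1 h2 h3
      rw [h1, Pi.add_apply, h2, h3, Finset.sum_insert hit]
  refine (Lp.norm_le_of_ae_bound zero_le_one ?_).trans_eq (by simp)
  filter_upwards [hcoe s] with x hx
  rw [hx]
  by_cases hex : ∃ i ∈ s, x ∈ A i
  · obtain ⟨i, hi, hxi⟩ := hex
    rw [Finset.sum_eq_single_of_mem i hi]
    · simpa [hxi] using hy i
    · intro j hj hji
      exact Set.indicator_of_notMem (fun hxj => (hd hj hi hji).le_bot ⟨hxj, hxi⟩) _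
  · push Not at hex
    rw [Finset.sum_eq_zero fun i hi => Set.indicator_of_notMem (hex i hi) _]
    simp

/-- Banach spaces are barrelled. -/
theorem barrelledSpace_of_completeSpace (𝕜 E : Type*) [RCLike 𝕜] [NormedAddCommGroup E]
    [NormedSpace 𝕜 E] [CompleteSpace E] : BarrelledSpace 𝕜 E :=
  inferInstance

section Pairing

variable (𝕜 : Type*) [RCLike 𝕜] {X : Type*} [NormedAddCommGroup X] [NormedSpace 𝕜 X]
  {S : Type*} [MeasurableSpace S] {μ : Measure S}

/-- The simple function `χ_A y` as an element of `S^∞(S, Y)`. -/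
noncomputable def SInfty.indicator {Y : Type*} [NormedAddCommGroup Y] [NormedSpace 𝕜 Y] [IsFiniteMeasure μ]
    {A : Set S} (hA : MeasurableSet A) (y : Y) : SInfty 𝕜 μ Y :=
  ⟨indicatorConstLp ∞ hA (measure_ne_top μ A) y, Submodule.le_topologicalClosure _
    (Submodule.subset_span ⟨A, hA, measure_ne_top μ A, y, rfl⟩)⟩

variable {𝕜}

/-- The pairing of `φ` with `χ_A x*` is `x* (∫ s in A, φ s ∂μ)`. -/
theorem pairingSInfty_indicator [NormedSpace ℝ X] [CompleteSpace X] [IsFiniteMeasure μ]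
    (φ : Lp X 1 μ) {A : Set S} (hA : MeasurableSet A) (x : StrongDual 𝕜 X) :
    pairingSInfty 𝕜 μ X φ (SInfty.indicator 𝕜 hA x) = x (∫ s in A, φ s ∂μ) := by
  rw [pairingSInfty_apply, ← x.integral_comp_comm (L1.integrable_coeFn φ).integrableOn,
    ← integral_indicator hA]
  refine integral_congr_ae ?_
  filter_upwards [indicatorConstLp_coeFn (p := ∞) (hs := hA) (hμs := measure_ne_top μ A) (c := x)]
    with s hs
  simp only [SInfty.indicator, hs]
  by_cases h : s ∈ A <;> simp [h]

variable (𝕜) in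
/-- The pairing with a fixed `φ` as a continuous linear functional on `S^∞(S, X*)`. -/
noncomputable def pairingSInftyCLM (φ : Lp X 1 μ) : SInfty 𝕜 μ (StrongDual 𝕜 X) →L[𝕜] 𝕜 :=
  ((ContinuousLinearMap.apply 𝕜 𝕜).lpPairing μ 1 ∞ φ).comp (SInfty 𝕜 μ (StrongDual 𝕜 X)).subtypeL

theorem pairingSInftyCLM_apply (φ : Lp X 1 μ) (f : SInfty 𝕜 μ (StrongDual 𝕜 X)) :
    pairingSInftyCLM 𝕜 φ f = pairingSInfty 𝕜 μ X φ f := rfl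

/-- Continuous linear functionals on `S^∞(S, Y)` agreeing on all `χ_A y` are equal. -/
theorem SInfty.clm_ext {Y : Type*} [NormedAddCommGroup Y] [NormedSpace 𝕜 Y] [IsFiniteMeasure μ]
    {L M : SInfty 𝕜 μ Y →L[𝕜] 𝕜}
    (h : ∀ (A : Set S) (hA : MeasurableSet A) (y : Y),
      L (SInfty.indicator 𝕜 hA y) = M (SInfty.indicator 𝕜 hA y)) : L = M := by
  have hspan : ∀ g (hg : g ∈ Submodule.span 𝕜 {f : Lp Y ∞ μ | ∃ (A : Set S)
      (hA : MeasurableSet A) (hμA : μ A ≠ ∞) (y : Y), f = indicatorConstLp ∞ hA hμA y}),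
      L ⟨g, Submodule.le_topologicalClosure _ hg⟩ = M ⟨g, Submodule.le_topologicalClosure _ hg⟩ := by
    intro g hg
    induction hg using Submodule.span_induction with
    | mem g hg =>
      obtain ⟨A, hA, hμA, y, rfl⟩ := hg
      exact h A hA y
    | zero => exact (map_zero L).trans (map_zero M).symm
    | add f g hf hg h1 h2 =>
      exact (map_add L ⟨f, _⟩ ⟨g, _⟩).trans ((congrArg₂ (· + ·) h1 h2).trans (map_add M ⟨f, _⟩ ⟨g, _⟩).symm)
    | smul c g hg h1 =>
      exact (map_smul L c ⟨g, _⟩).trans ((congrArg (c • ·) h1).trans (map_smul M c ⟨g, _⟩).symm)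
  ext ⟨f, hf⟩
  obtain ⟨u, hu, huf⟩ := mem_closure_iff_seq_limit.1 hf
  have hlim : Tendsto (fun n => (⟨u n, Submodule.le_topologicalClosure _ (hu n)⟩ : SInfty 𝕜 μ Y))
      atTop (𝓝 ⟨f, hf⟩) := tendsto_subtype_rng.2 huf
  refine tendsto_nhds_unique ((L.continuous.tendsto _).comp hlim) ?_
  refine ((M.continuous.tendsto _).comp hlim).congr fun n => ?_
  exact (hspan _ (hu n)).symm

/-- A continuous linear functional on `S^∞(S, X*)` represented on simple functions by a set
function `F` bounds the variation of `F`. -/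
theorem sum_norm_le_of_forall_indicator [IsFiniteMeasure μ]
    {L : SInfty 𝕜 μ (StrongDual 𝕜 X) →L[𝕜] 𝕜} {F : Set S → X}
    (hF : ∀ (A : Set S) (hA : MeasurableSet A) (x : StrongDual 𝕜 X),
      L (SInfty.indicator 𝕜 hA x) = x (F A))
    {ι : Type*} (s : Finset ι) {A : ι → Set S} (hA : ∀ i, MeasurableSet (A i))
    (hd : (s : Set ι).PairwiseDisjoint A) : ∑ i ∈ s, ‖F (A i)‖ ≤ ‖L‖ := by
  choose x hx hxF using fun i => exists_dual_vector'' 𝕜 (F (A i))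
  have h1 : L (∑ i ∈ s, SInfty.indicator 𝕜 (hA i) (x i)) = ((∑ i ∈ s, ‖F (A i)‖ : ℝ) : 𝕜) := by
    rw [map_sum, RCLike.ofReal_sum]
    exact Finset.sum_congr rfl fun i _ => by rw [hF, hxF]
  have h2 : ‖∑ i ∈ s, SInfty.indicator (μ := μ) 𝕜 (hA i) (x i)‖ ≤ 1 := by
    rw [← Submodule.norm_coe, Submodule.coe_sum]
    exact norm_sum_indicatorConstLp_top_le_one s hA hd hx
  have h3 := L.le_of_opNorm_le_of_le le_rfl h2
  rwa [h1, RCLike.norm_ofReal, abs_of_nonneg (Finset.sum_nonneg fun _ _ => norm_nonneg _),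
    mul_one] at h3

/-- A continuous linear functional on `S^∞(S, X*)` that is the pointwise limit of pairings with
elements of `L¹(S, X)` comes from a countably additive `X`-valued measure, if `X` is weakly
sequentially complete. -/
theorem exists_vectorMeasure_of_tendsto_pairingSInfty [NormedSpace ℝ X] [CompleteSpace X]
    [IsFiniteMeasure μ] (hX : WeaklySequentiallyComplete 𝕜 X) {u : ℕ → Lp X 1 μ}
    {L : SInfty 𝕜 μ (StrongDual 𝕜 X) →L[𝕜] 𝕜}
    (hL : ∀ f, Tendsto (fun n => pairingSInfty 𝕜 μ X (u n) f) atTop (𝓝 (L f))) :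
    ∃ F : VectorMeasure S X, ∀ (A : Set S) (hA : MeasurableSet A) (x : StrongDual 𝕜 X),
      L (SInfty.indicator 𝕜 hA x) = x (F A) := by
  classical
  have hlim : ∀ (A : Set S) (hA : MeasurableSet A) (x : StrongDual 𝕜 X),
      Tendsto (fun n => x (∫ s in A, u n s ∂μ)) atTop (𝓝 (L (SInfty.indicator 𝕜 hA x))) := by
    intro A hA x
    simpa only [pairingSInfty_indicator] using hL (SInfty.indicator 𝕜 hA x)
  have hex : ∀ A : Set S, ∃ y : X, (∀ (hA : MeasurableSet A) (x : StrongDual 𝕜 X),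
      L (SInfty.indicator 𝕜 hA x) = x y) ∧ (¬ MeasurableSet A → y = 0) := by
    intro A
    by_cases hA : MeasurableSet A
    · obtain ⟨y, hy⟩ := hX (fun n => ∫ s in A, u n s ∂μ) fun x => (hlim A hA x).cauchySeq
      refine ⟨y, fun _ x => tendsto_nhds_unique (hlim A hA x) ?_, fun h => (h hA).elim⟩
      exact ((WeakBilin.eval_continuous (topDualPairing 𝕜 X).flip x).tendsto _).comp hy
    · exact ⟨0, fun h => (hA h).elim, fun _ => rfl⟩
  choose F hF hF0 using hex
  refine ⟨⟨F, ?_, fun A hA => hF0 A hA, fun A hA hd => ?_⟩, hF⟩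
  · refine (SeparatingDual.eq_zero_iff_forall_dual_eq_zero (R := 𝕜) _).2 fun x => ?_
    refine tendsto_nhds_unique (hF ∅ .empty x ▸ hlim ∅ .empty x) ?_
    simp
  -- `HasSum` is unconditional, whereas Nikodym only controls partial sums over `Finset.range`; the
  -- variation bound fills the gap.
  · have hsum : Summable fun i => F (A i) := by
      refine .of_norm (summable_of_sum_le (c := ‖L‖) (fun _ => norm_nonneg _) fun s => ?_)
      exact sum_norm_le_of_forall_indicator hF s hA (hd.set_pairwise _)
    convert hsum.hasSum
    refine (SeparatingDual.eq_iff_forall_dual_eq (R := 𝕜)).2 fun x => ?_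
    have h1 := tendsto_sum_range_of_forall_tendsto_setIntegral (μ := μ) (h := fun n s => x (u n s))
      (ν := fun A => x (F A)) (fun n => x.integrable_comp (L1.integrable_coeFn (u n)))
      (fun A hA => (hF A hA x ▸ hlim A hA x).congr fun n =>
        (x.integral_comp_comm (L1.integrable_coeFn (u n)).integrableOn).symm) hA hd
    exact tendsto_nhds_unique h1 (hsum.hasSum.mapL x).tendsto_sum_nat

end Pairing

theorem mainTheorem7 {𝕜 : Type*} [RCLike 𝕜] {X : Type*} [NormedAddCommGroup X] [NormedSpace 𝕜 X]
    [NormedSpace ℝ X] [CompleteSpace X] {S : Type*} [MeasurableSpace S] (μ : Measure S)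
    [IsFiniteMeasure μ] (hX : WeaklySequentiallyComplete 𝕜 X) (hRNP : HasRNP μ X) :
    SigmaSequentiallyComplete (pairingSInfty 𝕜 μ X) := by
  intro u hu
  have : CompleteSpace (SInfty 𝕜 μ (StrongDual 𝕜 X)) :=
    (Submodule.isClosed_topologicalClosure _).completeSpace_coe
  have : BarrelledSpace 𝕜 (SInfty 𝕜 μ (StrongDual 𝕜 X)) :=
    barrelledSpace_of_completeSpace 𝕜 _
  choose l hl using fun f => cauchySeq_tendsto_of_complete (hu f)
  let L : SInfty 𝕜 μ (StrongDual 𝕜 X) →L[𝕜] 𝕜 :=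
    continuousLinearMapOfTendsto (fun n => pairingSInftyCLM 𝕜 (u n)) (tendsto_pi_nhds.2 hl)
  have hL : ∀ f, Tendsto (fun n => pairingSInfty 𝕜 μ X (u n) f) atTop (𝓝 (L f)) := hl
  obtain ⟨F, hF⟩ := exists_vectorMeasure_of_tendsto_pairingSInfty hX hL
  have hvar : F.variation Set.univ < ∞ := by
    refine lt_of_le_of_lt (not_lt.1 fun hlt => ?_) (ENNReal.ofReal_lt_top (r := ‖L‖))
    -- A variation above `‖L‖` would already be exceeded on a finite disjoint family.
    obtain ⟨P, -, hd, hm, hP⟩ := F.exists_lt_sum_of_lt_variation .univ hlt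
    refine hP.not_ge ?_
    have h := sum_norm_le_of_forall_indicator hF P.attach (A := fun p => (p : Set S))
      (fun p => hm p p.2) fun p _ q _ hpq => hd p.2 q.2 (Subtype.coe_injective.ne hpq)
    rw [P.sum_attach fun p => ‖F p‖] at h
    simp_rw [← ofReal_norm]
    rw [← ENNReal.ofReal_sum_of_nonneg fun _ _ => norm_nonneg _]
    exact ENNReal.ofReal_le_ofReal h
  have hac : ∀ A : Set S, MeasurableSet A → μ A = 0 → F A = 0 := by
    intro A hA hμA
    refine (SeparatingDual.eq_zero_iff_forall_dual_eq_zero (R := 𝕜) _).2 fun x => ?_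
    rw [← hF A hA x]
    refine tendsto_nhds_unique (hL _) (tendsto_const_nhds.congr fun n => ?_)
    refine ((pairingSInfty_indicator (u n) hA x).trans ?_).symm
    rw [Measure.restrict_eq_zero.2 hμA, integral_zero_measure, map_zero]
  obtain ⟨φ, hφ⟩ := hRNP F hvar hac
  have hLφ : L = pairingSInftyCLM 𝕜 φ := SInfty.clm_ext fun A hA x => by
    rw [hF, pairingSInftyCLM_apply, pairingSInfty_indicator, hφ A hA]
  refine ⟨φ, ?_⟩
  -- The topology of `WeakBilin` is by definition induced by these evaluations.
  have hind : IsInducing fun (x : WeakBilin (pairingSInfty 𝕜 μ X)) y =>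
    pairingSInfty 𝕜 μ X x y := ⟨rfl⟩
  refine hind.tendsto_nhds_iff.2 (tendsto_pi_nhds.2 fun f => ?_)
  have := hL f
  rwa [hLφ] at this
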